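/- Let $(\mathcal F,\mathcal S)$ be a Frobenius category, i.e. an exact category (an additive category with a family $\mathcal S$ of kernel–cokernel pairs satisfying Quillen's axioms) that has enough $\mathcal S$-projective and enough $\mathcal S$-injective objects and in which the $\mathcal S$-projective objects are exactly the $\mathcal S$-injective objects. Let $\operatorname{inj}\mathcal F$ be the class of $\mathcal S$-injective objects, and let $\underline{\mathcal F}=\mathcal F/\operatorname{inj}\mathcal F$ be the stable category: it has the same objects as $\mathcal F$, and its morphisms are those of $\mathcal F$ modulo the morphisms that factor through an $\mathcal S$-injective object. Choose for every object $X$ a sequence $X\xrightarrow{\mu}I\xrightarrow{\pi}TX$ in $\mathcal S$ with $I$ $\mathcal S$-injective, and equip $\underline{\mathcal F}$ with the resulting suspension functor $T$ and with the distinguished triangles, i.e. the triangles isomorphic in $\underline{\mathcal F}$ to the image of some $X\xrightarrow{f}Y\xrightarrow{g}C_f\xrightarrow{h}TX$, where $C_f$ is the pushout of $\mu$ and $f$ with structure maps $\overline f:I\to C_f$ and $g:Y\to C_f$, $h\overline f=\pi$ and $(g,h)\in\mathcal S$. A nonempty full subcategory of $\mathcal F$ is called complete if, whenever two of the objects of a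 sequence $X\to Y\to Z$ in $\mathcal S$ belong to it, so does the third; it is called thick if in addition it is closed under direct summands. A nonempty full subcategory of $\underline{\mathcal F}$ is called triangulated if, whenever two of the objects $X,Y,Z$ of a distinguished triangle $X\to Y\to Z\to TX$ belong to it, so does the third; it is called thick triangulated if in addition it is closed under direct summands. Here an object $A$ is a direct summand of $X$ if there are morphisms $A\to X\to A$ with composite $1_A$. For a full subcategory $\mathcal D$ of $\mathcal F$ let $F\mathcal D$ be the full subcategory of $\underline{\mathcal F}$ with the same objects as $\mathcal D$, and for a full subcategory $\mathcal T'$ of $\underline{\mathcal F}$ let $G\mathcal T'$ be the full subcategory of $\mathcal F$ with the same objects as $\mathcal T'$. Then: (1) $F$ and $G$ restrict to mutually inverse bijections between the thick subcategories of $\mathcal F$ containing $\operatorname{inj}\mathcal F$ and the thick triangulated subcategories of $\underline{\mathcal F}$. (2) $F$ and $G$ restrict to mutually inverse bijections between the complete subcategories of $\mathcal F$ containing $\operatorname{inj}\mathcal F$ and the triangulated subcategories of $\underline{\mathcal F}$. -/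

import Mathlib

open CategoryTheory CategoryTheory.Limits

universe v u

namespace FrobeniusClassification

section Exact

variable {C : Type u} [Category.{v} C] [Preadditive C]

/-- `g` is the second map of a sequence in the family `S`. -/
def AdmissibleEpi (S : ObjectProperty (ShortComplex C)) {Y Z : C} (g : Y ⟶ Z) : Prop :=
  ∃ (X : C) (f : X ⟶ Y) (w : f ≫ g = 0), S (ShortComplex.mk f g w)

/-- `f` is the first map of a sequence in the family `S`. -/
def AdmissibleMono (S : ObjectProperty (ShortComplex C)) {X Y : C} (f : X ⟶ Y) : Prop :=
  ∃ (Z : C) (g : Y ⟶ Z) (w : f ≫ g = 0), S (ShortComplex.mk f g w)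

/-- A sequence `X ⟶ Y ⟶ Z` is a kernel-cokernel pair if the first map is a kernel of the second
and the second map is a cokernel of the first. -/
def IsKernelCokernelPair (K : ShortComplex C) : Prop :=
  Nonempty (IsLimit (KernelFork.ofι K.f K.zero)) ∧
    Nonempty (IsColimit (CokernelCofork.ofπ K.g K.zero))

/-- An exact structure on an additive category (Quillen's notion, in Keller's axiomatisation). -/
structure ExactStructure (C : Type u) [Category.{v} C] [Preadditive C]
    [HasZeroObject C] [HasBinaryBiproducts C] where
  /-- the family of short exact sequences -/
  conflation : ObjectProperty (ShortComplex C)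
  isKernelCokernelPair : ∀ K : ShortComplex C, conflation K → IsKernelCokernelPair K
  of_iso : ∀ {K L : ShortComplex C}, (K ≅ L) → conflation K → conflation L
  id_zero : ∀ O : C, IsZero O → AdmissibleEpi conflation (𝟙 O)
  comp : ∀ {X Y Z : C} (f : X ⟶ Y) (g : Y ⟶ Z),
    AdmissibleEpi conflation f → AdmissibleEpi conflation g → AdmissibleEpi conflation (f ≫ g)
  pullback : ∀ {B A A' : C} (g : B ⟶ A) (h : A' ⟶ A), AdmissibleEpi conflation g →
    ∃ (B' : C) (h' : B' ⟶ B) (g' : B' ⟶ A'), IsPullback h' g' g h ∧ AdmissibleEpi conflation g'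
  pushout : ∀ {A B A' : C} (f : A ⟶ B) (h : A ⟶ A'), AdmissibleMono conflation f →
    ∃ (B' : C) (h' : B ⟶ B') (f' : A' ⟶ B'), IsPushout f h h' f' ∧ AdmissibleMono conflation f'

/-- The relation on morphisms whose quotient is `C / N`: the difference of the two morphisms
factors through an object of `N`. -/
def factorRel (N : ObjectProperty C) : HomRel C := fun X Y f g =>
  ∃ (W : C) (a : X ⟶ W) (b : W ⟶ Y), N W ∧ f - g = a ≫ b

namespace ExactStructure

variable [HasZeroObject C] [HasBinaryBiproducts C] (S : ExactStructure C)

/-- The projective objects with respect to the exact structure. -/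
def proj : ObjectProperty C := fun P =>
  ∀ ⦃Y Z : C⦄ (g : Y ⟶ Z), AdmissibleEpi S.conflation g → ∀ a : P ⟶ Z, ∃ b : P ⟶ Y, b ≫ g = a

/-- The injective objects with respect to the exact structure. -/
def inj : ObjectProperty C := fun I =>
  ∀ ⦃X Y : C⦄ (f : X ⟶ Y), AdmissibleMono S.conflation f → ∀ a : X ⟶ I, ∃ b : Y ⟶ I, f ≫ b = a

/-- The exact category is Frobenius. -/
structure IsFrobenius : Prop where
  enough_proj : ∀ X : C, ∃ (P : C) (g : P ⟶ X), S.proj P ∧ AdmissibleEpi S.conflation g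
  enough_inj : ∀ X : C, ∃ (I : C) (f : X ⟶ I), S.inj I ∧ AdmissibleMono S.conflation f
  proj_eq_inj : S.proj = S.inj

/-- A nonempty full subcategory (given by its objects) with the two out of three property for
short exact sequences. -/
structure IsComplete (D : ObjectProperty C) : Prop where
  nonempty : ∃ X, D X
  left : ∀ K, S.conflation K → D K.X₂ → D K.X₃ → D K.X₁
  middle : ∀ K, S.conflation K → D K.X₁ → D K.X₃ → D K.X₂
  right : ∀ K, S.conflation K → D K.X₁ → D K.X₂ → D K.X₃

/-- A complete subcategory that is closed under direct summands. -/
structure IsThick (D : ObjectProperty C) : Prop extends S.IsComplete D where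
  summand : ∀ {A X : C}, Retract A X → D X → D A

/-! ### The stable category -/

lemma inj_zero {O : C} (hO : IsZero O) : S.inj O := fun _ _ _ _ _ =>
  ⟨0, hO.eq_of_tgt _ _⟩

lemma inj_biprod {I J : C} (hI : S.inj I) (hJ : S.inj J) : S.inj (I ⊞ J) := by
  intro X Y f hf a
  obtain ⟨b, hb⟩ := hI f hf (a ≫ biprod.fst)
  obtain ⟨c, hc⟩ := hJ f hf (a ≫ biprod.snd)
  exact ⟨biprod.lift b c, by ext <;> simp [hb, hc]⟩

lemma factorRel_add {X Y : C} {f₁ f₂ g₁ g₂ : X ⟶ Y} (hf : factorRel S.inj f₁ f₂)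
    (hg : factorRel S.inj g₁ g₂) : factorRel S.inj (f₁ + g₁) (f₂ + g₂) := by
  obtain ⟨I, a, b, hI, h⟩ := hf
  obtain ⟨J, c, d, hJ, h'⟩ := hg
  refine ⟨I ⊞ J, biprod.lift a c, biprod.desc b d, S.inj_biprod hI hJ, ?_⟩
  rw [biprod.lift_desc, ← h, ← h']
  abel

instance congruence : Congruence (factorRel S.inj) where
  equivalence :=
    { refl := fun f => ⟨_, 0, 0, S.inj_zero (isZero_zero C), by simp⟩
      symm := by
        rintro f g ⟨I, a, b, hI, h⟩
        exact ⟨I, -a, b, hI, by rw [Preadditive.neg_comp, ← h]; abel⟩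
      trans := by
        rintro f g k ⟨I, a, b, hI, h⟩ ⟨J, c, d, hJ, h'⟩
        refine ⟨I ⊞ J, biprod.lift a c, biprod.desc b d, S.inj_biprod hI hJ, ?_⟩
        rw [biprod.lift_desc, ← h, ← h']
        abel }
  comp_left := by
    rintro X Y Z f g g' ⟨I, a, b, hI, h⟩
    exact ⟨I, f ≫ a, b, hI, by rw [← Preadditive.comp_sub, h, Category.assoc]⟩
  comp_right := by
    rintro X Y Z f f' g ⟨I, a, b, hI, h⟩
    exact ⟨I, a, b ≫ g, hI, by rw [← Preadditive.sub_comp, h, Category.assoc]⟩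

/-- The stable category `C / inj C`: the objects of `C`, with morphisms modulo those that factor
through an injective object. -/
abbrev Stable : Type u := CategoryTheory.Quotient (factorRel S.inj)

instance : Preadditive S.Stable :=
  CategoryTheory.Quotient.preadditive _ fun _ _ _ _ _ _ hf hg => S.factorRel_add hf hg

/-- The projection from `C` to its stable category. -/
abbrev toStable : C ⥤ S.Stable := CategoryTheory.Quotient.functor _

lemma toStable_map_eq_iff {X Y : C} (f g : X ⟶ Y) :
    S.toStable.map f = S.toStable.map g ↔ factorRel S.inj f g :=
  CategoryTheory.Quotient.functor_map_eq_iff _ f g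

/-! ### The suspension functor -/

/-- A short exact sequence `X ⟶ I ⟶ X'` with `I` injective. -/
structure InjSeq (X : C) where
  I : C
  susp : C
  ι : X ⟶ I
  π : I ⟶ susp
  w : ι ≫ π = 0
  mem : S.conflation (ShortComplex.mk ι π w)
  inj : S.inj I

variable {S}

namespace InjSeq

lemma nonempty (hS : S.IsFrobenius) (X : C) : Nonempty (S.InjSeq X) := by
  obtain ⟨I, f, hI, X', g, w, h⟩ := hS.enough_inj X
  exact ⟨⟨I, X', f, g, w, h, hI⟩⟩

variable {X Y Z : C} (A : S.InjSeq X) (B : S.InjSeq Y) (D : S.InjSeq Z)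

lemma admissible : AdmissibleMono S.conflation A.ι := ⟨_, _, A.w, A.mem⟩

lemma exists_desc {W : C} (k : A.I ⟶ W) (hk : A.ι ≫ k = 0) : ∃ l : A.susp ⟶ W, A.π ≫ l = k := by
  obtain ⟨hc⟩ := (S.isKernelCokernelPair _ A.mem).2
  exact ⟨hc.desc (CokernelCofork.ofπ k hk), hc.fac _ WalkingParallelPair.one⟩

lemma π_cancel {W : C} {k l : A.susp ⟶ W} (h : A.π ≫ k = A.π ≫ l) : k = l := by
  obtain ⟨hc⟩ := (S.isKernelCokernelPair _ A.mem).2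
  exact Cofork.IsColimit.hom_ext hc h

/-- `f'` completes `f` to a morphism between the chosen short exact sequences. -/
def IsLift (f : X ⟶ Y) (f' : A.susp ⟶ B.susp) : Prop :=
  ∃ k : A.I ⟶ B.I, A.ι ≫ k = f ≫ B.ι ∧ A.π ≫ f' = k ≫ B.π

lemma exists_isLift (f : X ⟶ Y) : ∃ f' : A.susp ⟶ B.susp, IsLift A B f f' := by
  obtain ⟨k, hk⟩ := B.inj A.ι A.admissible (f ≫ B.ι)
  obtain ⟨l, hl⟩ := A.exists_desc (k ≫ B.π) (by rw [← Category.assoc, hk, Category.assoc, B.w,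
    comp_zero])
  exact ⟨l, k, hk, hl⟩

variable {A B D}

lemma IsLift.unique {f g : X ⟶ Y} {f' g' : A.susp ⟶ B.susp} (hf : IsLift A B f f')
    (hg : IsLift A B g g') (h : factorRel S.inj f g) : factorRel S.inj f' g' := by
  obtain ⟨k, hk, hk'⟩ := hf
  obtain ⟨l, hl, hl'⟩ := hg
  obtain ⟨J, a, b, hJ, hab⟩ := h
  obtain ⟨c, hc⟩ := hJ A.ι A.admissible a
  obtain ⟨s, hs⟩ := A.exists_desc (k - l - (c ≫ b) ≫ B.ι) (by
    simp only [Preadditive.comp_sub, hk, hl]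
    rw [← Preadditive.sub_comp, hab, ← hc]
    simp)
  refine ⟨B.I, s, B.π, B.inj, A.π_cancel ?_⟩
  rw [Preadditive.comp_sub, hk', hl', ← Category.assoc, hs]
  simp [Preadditive.sub_comp, B.w]

lemma isLift_id : IsLift A A (𝟙 X) (𝟙 _) := ⟨𝟙 _, by simp, by simp⟩

lemma IsLift.comp {f : X ⟶ Y} {g : Y ⟶ Z} {f' : A.susp ⟶ B.susp} {g' : B.susp ⟶ D.susp}
    (hf : IsLift A B f f') (hg : IsLift B D g g') : IsLift A D (f ≫ g) (f' ≫ g') := by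
  obtain ⟨k, hk, hk'⟩ := hf
  obtain ⟨l, hl, hl'⟩ := hg
  refine ⟨k ≫ l, ?_, ?_⟩
  · rw [← Category.assoc, hk, Category.assoc, hl, Category.assoc]
  · rw [← Category.assoc, hk', Category.assoc, hl', Category.assoc]

end InjSeq

/-- The suspension `T : Stable ⥤ Stable` attached to a choice of a short exact sequence
`X ⟶ I ⟶ T X` with `I` injective for each object `X`. A morphism `f` goes to the class of any `f'`
completing `f` to a morphism of these sequences. -/
noncomputable def suspension (σ : ∀ X : C, S.InjSeq X) : S.Stable ⥤ S.Stable :=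
  CategoryTheory.Quotient.lift (factorRel S.inj)
    { obj := fun X => S.toStable.obj (σ X).susp
      map := fun {X Y} f => S.toStable.map ((σ X).exists_isLift (σ Y) f).choose
      map_id := fun X => by
        rw [← S.toStable.map_id, toStable_map_eq_iff]
        exact InjSeq.IsLift.unique (Exists.choose_spec _) InjSeq.isLift_id
          ((congruence S).equivalence.refl _)
      map_comp := fun {X Y Z} f g => by
        rw [← S.toStable.map_comp, toStable_map_eq_iff]
        exact InjSeq.IsLift.unique (Exists.choose_spec _)
          (InjSeq.IsLift.comp (Exists.choose_spec ((σ X).exists_isLift (σ Y) f))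
            (Exists.choose_spec ((σ Y).exists_isLift (σ Z) g)))
          ((congruence S).equivalence.refl _) }
    (fun X Y f g h => by
      rw [toStable_map_eq_iff]
      exact InjSeq.IsLift.unique (Exists.choose_spec ((σ X).exists_isLift (σ Y) f))
        (Exists.choose_spec ((σ X).exists_isLift (σ Y) g)) h)

/-- Any completion of `f` to a morphism of the chosen sequences represents `T f`. -/
lemma suspension_map (σ : ∀ X : C, S.InjSeq X) {X Y : C} (f : X ⟶ Y)
    (f' : (σ X).susp ⟶ (σ Y).susp) (h : InjSeq.IsLift (σ X) (σ Y) f f') :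
    (suspension σ).map (S.toStable.map f) = S.toStable.map f' := by
  change S.toStable.map _ = _
  rw [toStable_map_eq_iff]
  exact InjSeq.IsLift.unique (Exists.choose_spec ((σ X).exists_isLift (σ Y) f)) h
    ((congruence S).equivalence.refl _)

end ExactStructure

end Exact

section Triangles

variable {D : Type u} [Category.{v} D]

/-- A triangle `X ⟶ Y ⟶ Z ⟶ T X` for an endofunctor `T`. -/
structure Tri (T : D ⥤ D) where
  {X Y Z : D}
  f : X ⟶ Y
  g : Y ⟶ Z
  h : Z ⟶ T.obj X

/-- Two triangles are isomorphic. -/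
def Tri.Isomorphic {T : D ⥤ D} (A B : Tri T) : Prop :=
  ∃ (a : A.X ≅ B.X) (b : A.Y ≅ B.Y) (c : A.Z ≅ B.Z),
    A.f ≫ b.hom = a.hom ≫ B.f ∧ A.g ≫ c.hom = b.hom ≫ B.g ∧ A.h ≫ T.map a.hom = c.hom ≫ B.h

/-- A nonempty full subcategory `P` (given by its objects) of a category with a suspension `T` and
a class `Δ` of distinguished triangles is a triangulated subcategory if it has the two out of three
property for distinguished triangles. -/
structure IsTriangulatedSubcategory {T : D ⥤ D} (Δ : Set (Tri T)) (P : ObjectProperty D) :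
    Prop where
  nonempty : ∃ X, P X
  left : ∀ A ∈ Δ, P A.Y → P A.Z → P A.X
  middle : ∀ A ∈ Δ, P A.X → P A.Z → P A.Y
  right : ∀ A ∈ Δ, P A.X → P A.Y → P A.Z

/-- A triangulated subcategory that is closed under direct summands. -/
structure IsThickTriangulatedSubcategory {T : D ⥤ D} (Δ : Set (Tri T)) (P : ObjectProperty D) :
    Prop extends IsTriangulatedSubcategory Δ P where
  summand : ∀ {A X : D}, Retract A X → P X → P A

end Triangles

namespace ExactStructure

variable {C : Type u} [Category.{v} C] [Preadditive C] [HasZeroObject C] [HasBinaryBiproducts C]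
  {S : ExactStructure C}

/-- The standard triangles `X ⟶ Y ⟶ E ⟶ T X` of the stable category: `E` is the pushout of
`f : X ⟶ Y` along the chosen `X ⟶ I`, and `h` is the map making `Y ⟶ E ⟶ T X` short exact and
compatible with `I ⟶ T X`. -/
inductive IsStandard (σ : ∀ X : C, S.InjSeq X) : Tri (suspension σ) → Prop
  | mk {X Y E : C} (f : X ⟶ Y) (f' : (σ X).I ⟶ E) (g : Y ⟶ E) (h : E ⟶ (σ X).susp)
      (w : g ≫ h = 0) (po : IsPushout (σ X).ι f f' g) (comm : f' ≫ h = (σ X).π)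
      (mem : S.conflation (ShortComplex.mk g h w)) :
      IsStandard σ
        { X := S.toStable.obj X, Y := S.toStable.obj Y, Z := S.toStable.obj E
          f := S.toStable.map f, g := S.toStable.map g, h := S.toStable.map h }

/-- The distinguished triangles of the stable category: those isomorphic to a standard one. -/
def distinguished (σ : ∀ X : C, S.InjSeq X) : Set (Tri (suspension σ)) :=
  {A | ∃ B, IsStandard σ B ∧ A.Isomorphic B}

variable (S)

/-- The full subcategory of the stable category with the same objects as `D`. -/
def mapF (D : ObjectProperty C) : ObjectProperty S.Stable := fun X => D X.as

/-- The full subcategory of `C` with the same objects as `P`. -/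
def mapG (P : ObjectProperty S.Stable) : ObjectProperty C := fun X => P (S.toStable.obj X)

end ExactStructure

end FrobeniusClassification

/-!
A subcategory of the stable category and a subcategory of the Frobenius category are given by the
same datum, a class of objects, and `mapF` and `mapG` are inverse to each other on the nose. Hence
the theorem says that a class of objects `D` is complete (thick) and contains the injective objects
if and only if it is triangulated (thick triangulated) in the stable category.

Suppose that `D` is complete and contains the injective objects. The sequences `X ⟶ I ⟶ T X` and
`Y ⟶ E ⟶ T X` attached to a standard triangle show that `D` has the two out of three property for
standard triangles. Distinguished triangles are only isomorphic to standard ones, so it remains to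
see that `D` is closed under stable isomorphisms `X ⟶ Y`. The cone `E` of a stable isomorphism is
injective (`inj_cone_of_isIso`), so the sequence `Y ⟶ E ⟶ T X` reduces the question to
`X ⟶ I ⟶ T X`. A retract `A` of `X` in the stable category is a genuine retract of `X ⊞ J` for an
injective object `J`, whence the thick case.

Conversely, let `P` be triangulated. The triangles `X ⟶ X ⟶ 0 ⟶ T X` show that `P` contains the
zero object and is closed under isomorphisms. For a short exact sequence `X ⟶ Y ⟶ Z`, the cone `E`
of `X ⟶ Y` is an extension of `Z` by the injective object `I`; this extension splits, so `E` and `Z`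
are stably isomorphic (`isIso_toStable_map_of_conflation`), and the standard triangle on `X ⟶ Y`
gives the two out of three property.
-/

namespace FrobeniusClassification

lemma Tri.Isomorphic.refl {D : Type u} [Category.{v} D] {T : D ⥤ D} (A : Tri T) :
    A.Isomorphic A :=
  ⟨Iso.refl _, Iso.refl _, Iso.refl _, by simp, by simp, by simp⟩

namespace ExactStructure

open scoped ZeroObject

variable {C : Type u} [Category.{v} C] [Preadditive C] [HasZeroObject C] [HasBinaryBiproducts C]
  {S : ExactStructure C}

/-! ### Short exact sequences -/

lemma exists_desc_of_conflation {K : ShortComplex C} (hK : S.conflation K) {W : C}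
    (k : K.X₂ ⟶ W) (hk : K.f ≫ k = 0) : ∃ l : K.X₃ ⟶ W, K.g ≫ l = k := by
  obtain ⟨hc⟩ := (S.isKernelCokernelPair _ hK).2
  exact ⟨hc.desc (CokernelCofork.ofπ k hk), hc.fac _ WalkingParallelPair.one⟩

lemma epi_of_conflation {K : ShortComplex C} (hK : S.conflation K) : Epi K.g := by
  obtain ⟨hc⟩ := (S.isKernelCokernelPair _ hK).2
  exact ⟨fun _ _ h => Cofork.IsColimit.hom_ext hc h⟩

/-- A pushout of the first map of a short exact sequence is the first map of a short exact sequence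
with the same third term. -/
lemma conflation_of_isPushout {A B Q A' B' : C} {i : A ⟶ B} {p : B ⟶ Q} {w : i ≫ p = 0}
    (hip : S.conflation (ShortComplex.mk i p w)) {f : A ⟶ A'} {h : B ⟶ B'} {f' : A' ⟶ B'}
    (po : IsPushout i f h f') :
    ∃ (q : B' ⟶ Q) (w' : f' ≫ q = 0), h ≫ q = p ∧ S.conflation (ShortComplex.mk f' q w') := by
  obtain ⟨B₂, h₂, f₂, po₂, Z, g, w₂, hc⟩ := S.pushout i f ⟨_, _, w, hip⟩
  have hq : i ≫ p = f ≫ (0 : A' ⟶ Q) := by rw [w, comp_zero]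
  refine ⟨po.desc p 0 hq, po.inr_desc _ _ _, po.inl_desc _ _ _, ?_⟩
  obtain ⟨l, hl⟩ := exists_desc_of_conflation hip (h₂ ≫ g)
    (by dsimp; rw [← Category.assoc, po₂.w, Category.assoc, w₂, comp_zero])
  obtain ⟨m, hm⟩ := exists_desc_of_conflation hc (po₂.desc p 0 hq) (po₂.inr_desc _ _ _)
  dsimp at l m hl hm
  have := epi_of_conflation hip
  have := epi_of_conflation hc
  dsimp at *
  have hlm : l ≫ m = 𝟙 Q := by
    rw [← cancel_epi p, ← Category.assoc, hl, Category.assoc, hm, po₂.inl_desc, Category.comp_id]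
  have hml : m ≫ l = 𝟙 Z := by
    rw [← cancel_epi g, ← Category.assoc, hm, Category.comp_id]
    apply po₂.hom_ext
    · rw [← Category.assoc, po₂.inl_desc, hl]
    · rw [← Category.assoc, po₂.inr_desc, w₂, zero_comp]
  refine S.of_iso (K := ShortComplex.mk f₂ g w₂) (ShortComplex.isoMk (Iso.refl _)
    (po₂.isoIsPushout _ _ po) ⟨m, l, hml, hlm⟩ ?_ ?_) hc
  · simp
  · apply po₂.hom_ext <;> simp [hm]

variable (S) in
/-- The split sequence `X ⟶ X ⊞ J ⟶ J` is a pushout of `0 ⟶ J ⟶ J`. -/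
lemma conflation_biprod (X J : C) :
    ∃ (q : X ⊞ J ⟶ J) (w : biprod.inl ≫ q = 0),
      S.conflation (ShortComplex.mk (biprod.inl : X ⟶ X ⊞ J) q w) := by
  -- `𝟙 J` is a base change of `𝟙 0`, hence the second map of a short exact sequence `K ⟶ J ⟶ J`.
  obtain ⟨B, h, g, pb, K, k, w, hk⟩ := S.pullback (𝟙 (0 : C)) (0 : J ⟶ 0)
    (S.id_zero _ (isZero_zero C))
  have : IsIso g := pb.isIso_snd_of_isIso
  have hk0 : k = 0 := by rw [← cancel_mono g, w, zero_comp]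
  have hK : IsZero K := by
    obtain ⟨hl⟩ := (S.isKernelCokernelPair _ hk).1
    rw [IsZero.iff_id_eq_zero]
    apply Fork.IsLimit.hom_ext hl
    change 𝟙 K ≫ k = 0 ≫ k
    rw [hk0, comp_zero, comp_zero]
  have hJ : S.conflation (ShortComplex.mk (0 : (0 : C) ⟶ J) (𝟙 J) zero_comp) :=
    S.of_iso (K := ShortComplex.mk k g w) (ShortComplex.isoMk (hK.iso (isZero_zero C))
      (asIso g) (Iso.refl _) (hK.eq_of_src _ _) (by simp)) hk
  obtain ⟨q, w', -, hq⟩ := conflation_of_isPushout hJ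
    (IsPushout.of_has_biproduct X J).flip
  exact ⟨q, w', hq⟩

/-! ### Vanishing in the stable category -/

instance : S.toStable.Additive := CategoryTheory.Quotient.functor_additive _ _

lemma toStable_map_eq_zero_iff {X Y : C} (f : X ⟶ Y) :
    S.toStable.map f = 0 ↔ ∃ (W : C) (a : X ⟶ W) (b : W ⟶ Y), S.inj W ∧ f = a ≫ b := by
  rw [← S.toStable.map_zero, toStable_map_eq_iff]
  simp [factorRel]

lemma isZero_toStable_obj {I : C} (hI : S.inj I) : IsZero (S.toStable.obj I) := by
  rw [IsZero.iff_id_eq_zero, ← S.toStable.map_id, toStable_map_eq_zero_iff]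
  exact ⟨I, 𝟙 I, 𝟙 I, hI, by simp⟩

lemma inj_of_retract {A I : C} (r : Retract A I) (hI : S.inj I) : S.inj A := by
  intro X Y f hf a
  obtain ⟨b, hb⟩ := hI f hf (a ≫ r.i)
  exact ⟨b ≫ r.r, by rw [← Category.assoc, hb, Category.assoc, r.retract, Category.comp_id]⟩

lemma inj_of_isZero_toStable_obj {X : C} (hX : IsZero (S.toStable.obj X)) : S.inj X := by
  rw [IsZero.iff_id_eq_zero, ← S.toStable.map_id, toStable_map_eq_zero_iff] at hX
  obtain ⟨W, a, b, hW, h⟩ := hX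
  exact inj_of_retract ⟨a, b, h.symm⟩ hW

/-- A map that vanishes stably factors through any admissible monomorphism out of its source. -/
lemma exists_factor_of_toStable_map_eq_zero {X Y I : C} {f : X ⟶ Y}
    (hf : S.toStable.map f = 0) {i : X ⟶ I} (hi : AdmissibleMono S.conflation i) :
    ∃ b : I ⟶ Y, f = i ≫ b := by
  obtain ⟨W, a, b, hW, h⟩ := (toStable_map_eq_zero_iff f).1 hf
  obtain ⟨c, hc⟩ := hW i hi a
  exact ⟨c ≫ b, by rw [h, ← hc, Category.assoc]⟩

/-! ### Cones -/

/-- The cone of a stable isomorphism is injective. -/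
lemma inj_cone_of_isIso {X Y E : C} (A : S.InjSeq X) {f : X ⟶ Y} {f' : A.I ⟶ E} {g : Y ⟶ E}
    {h : E ⟶ A.susp} {w : g ≫ h = 0} (po : IsPushout A.ι f f' g) (comm : f' ≫ h = A.π)
    (mem : S.conflation (ShortComplex.mk g h w)) [hf : IsIso (S.toStable.map f)] : S.inj E := by
  obtain ⟨e, he⟩ := S.toStable.map_surjective (inv (S.toStable.map f))
  have hI := isZero_toStable_obj A.inj
  have hg : S.toStable.map g = 0 := by
    rw [← cancel_epi (S.toStable.map f), comp_zero, ← S.toStable.map_comp, ← po.w,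
      S.toStable.map_comp, hI.eq_of_tgt (S.toStable.map A.ι) 0, zero_comp]
  -- `h` factors through `A.I`: if `𝟙 X = f ≫ e + A.ι ≫ b`, the maps `𝟙 - b ≫ A.ι` on `A.I` and
  -- `e ≫ A.ι` on `Y` glue to `c : E ⟶ A.I`, and `c ≫ A.π` agrees with `h` on `A.I` and on `Y`.
  obtain ⟨b, hb⟩ := exists_factor_of_toStable_map_eq_zero (f := 𝟙 X - f ≫ e)
    (by rw [S.toStable.map_sub, S.toStable.map_comp, he]; simp) A.admissible
  have hc : A.ι ≫ (𝟙 A.I - b ≫ A.ι) = f ≫ e ≫ A.ι := by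
    rw [Preadditive.comp_sub, ← Category.assoc, ← hb]
    simp
  have hh : S.toStable.map h = 0 := by
    have : h = po.desc _ _ hc ≫ A.π := by
      apply po.hom_ext
      · simp [comm, A.w]
      · simp [w, A.w]
    rw [this, S.toStable.map_comp, hI.eq_of_src (S.toStable.map A.π) 0, comp_zero]
  -- As `g` vanishes stably, `g ≫ u = g` for some `u` that vanishes stably; then `𝟙 E - u` factors
  -- through `h`, which vanishes stably as well.
  obtain ⟨W, s, t, hW, hst⟩ := (toStable_map_eq_zero_iff g).1 hg
  obtain ⟨s', hs'⟩ := hW g ⟨_, h, w, mem⟩ s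
  obtain ⟨l, hl⟩ := exists_desc_of_conflation mem (𝟙 E - s' ≫ t) (by
    dsimp
    rw [Preadditive.comp_sub, ← Category.assoc, hs', ← hst, Category.comp_id, sub_self])
  apply inj_of_isZero_toStable_obj
  rw [IsZero.iff_id_eq_zero, ← S.toStable.map_id,
    show 𝟙 E = h ≫ l + s' ≫ t from (sub_eq_iff_eq_add.1 hl.symm),
    S.toStable.map_add, S.toStable.map_comp, hh, zero_comp, zero_add, toStable_map_eq_zero_iff]
  exact ⟨W, s', t, hW, rfl⟩

/-- The second map of a short exact sequence with injective first term is a stable isomorphism,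
because the sequence splits. -/
lemma isIso_toStable_map_of_conflation {K : ShortComplex C} (hK : S.conflation K)
    (hI : S.inj K.X₁) : IsIso (S.toStable.map K.g) := by
  obtain ⟨r, hr⟩ := hI K.f ⟨_, K.g, K.zero, hK⟩ (𝟙 _)
  obtain ⟨s, hs⟩ := exists_desc_of_conflation hK (𝟙 _ - r ≫ K.f) (by
    rw [Preadditive.comp_sub, ← Category.assoc, hr]; simp)
  have := epi_of_conflation hK
  refine ⟨S.toStable.map s, ?_, ?_⟩
  · rw [← S.toStable.map_comp, hs, S.toStable.map_sub, S.toStable.map_comp r,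
      (isZero_toStable_obj hI).eq_of_tgt (S.toStable.map r) 0, zero_comp, sub_zero,
      S.toStable.map_id]
  · rw [← S.toStable.map_comp, ← S.toStable.map_id]
    congr 1
    rw [← cancel_epi K.g, ← Category.assoc, hs]
    simp [Preadditive.sub_comp]

/-- Every morphism of the exact category occurs in a standard triangle. -/
lemma exists_standard (σ : ∀ X : C, S.InjSeq X) {X Y : C} (f : X ⟶ Y) :
    ∃ (E : C) (f' : (σ X).I ⟶ E) (g : Y ⟶ E) (h : E ⟶ (σ X).susp) (w : g ≫ h = 0),
      IsPushout (σ X).ι f f' g ∧ f' ≫ h = (σ X).π ∧ S.conflation (ShortComplex.mk g h w) := by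
  obtain ⟨E, f', g, po, -⟩ := S.pushout (σ X).ι f (σ X).admissible
  obtain ⟨h, w, comm, mem⟩ := conflation_of_isPushout (σ X).mem po
  exact ⟨E, f', g, h, w, po, comm, mem⟩

/-- The cone of the first map of a short exact sequence `X ⟶ Y ⟶ Z` is stably isomorphic to `Z`. The
connecting map to `T X` is not specified, as subcategories only see the vertices of a triangle. -/
lemma exists_distinguished_of_conflation (σ : ∀ X : C, S.InjSeq X) {K : ShortComplex C}
    (hK : S.conflation K) :
    ∃ A ∈ distinguished σ, A.X = S.toStable.obj K.X₁ ∧ A.Y = S.toStable.obj K.X₂ ∧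
      Nonempty (A.Z ≅ S.toStable.obj K.X₃) := by
  obtain ⟨E, f', g, h, w, po, comm, mem⟩ := exists_standard σ K.f
  obtain ⟨q, w', -, hq⟩ := conflation_of_isPushout hK po.flip
  have : IsIso (S.toStable.map q) := isIso_toStable_map_of_conflation hq (σ K.X₁).inj
  exact ⟨_, ⟨_, .mk K.f f' g h w po comm mem, Tri.Isomorphic.refl _⟩, rfl, rfl,
    ⟨asIso (S.toStable.map q)⟩⟩

/-! ### From subcategories of the exact category to the stable category -/

lemma IsComplete.susp_iff {D : ObjectProperty C} (hD : S.IsComplete D) (hI : S.inj ≤ D) {X : C}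
    (A : S.InjSeq X) : D A.susp ↔ D X :=
  ⟨fun h => hD.left _ A.mem (hI _ A.inj) h, fun h => hD.right _ A.mem h (hI _ A.inj)⟩

lemma IsComplete.of_stable_iso (σ : ∀ X : C, S.InjSeq X) {D : ObjectProperty C}
    (hD : S.IsComplete D) (hI : S.inj ≤ D) {X Y : C} (e : S.toStable.obj X ≅ S.toStable.obj Y)
    (hX : D X) : D Y := by
  obtain ⟨f, hf⟩ := S.toStable.map_surjective e.hom
  have : IsIso (S.toStable.map f) := hf ▸ inferInstance
  obtain ⟨E, f', g, h, w, po, comm, mem⟩ := exists_standard σ f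
  exact hD.left _ mem (hI _ (inj_cone_of_isIso (σ X) po comm mem))
    ((hD.susp_iff hI (σ X)).2 hX)

lemma IsComplete.isTriangulatedSubcategory_mapF (σ : ∀ X : C, S.InjSeq X) {D : ObjectProperty C}
    (hD : S.IsComplete D) (hI : S.inj ≤ D) :
    IsTriangulatedSubcategory (distinguished σ) (S.mapF D) where
  nonempty := hD.nonempty.imp' S.toStable.obj fun _ h => h
  left := by
    rintro A ⟨B, ⟨f, f', g, h, w, po, comm, mem⟩, a, b, c, -⟩ hY hZ
    exact hD.of_stable_iso σ hI a.symm ((hD.susp_iff hI (σ _)).1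
      (hD.right _ mem (hD.of_stable_iso σ hI b hY) (hD.of_stable_iso σ hI c hZ)))
  middle := by
    rintro A ⟨B, ⟨f, f', g, h, w, po, comm, mem⟩, a, b, c, -⟩ hX hZ
    exact hD.of_stable_iso σ hI b.symm (hD.left _ mem (hD.of_stable_iso σ hI c hZ)
      ((hD.susp_iff hI (σ _)).2 (hD.of_stable_iso σ hI a hX)))
  right := by
    rintro A ⟨B, ⟨f, f', g, h, w, po, comm, mem⟩, a, b, c, -⟩ hX hY
    exact hD.of_stable_iso σ hI c.symm (hD.middle _ mem (hD.of_stable_iso σ hI b hY)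
      ((hD.susp_iff hI (σ _)).2 (hD.of_stable_iso σ hI a hX)))

/-- A stable retract of `X` is a retract of `X ⊞ J` for some injective object `J`. -/
lemma exists_retract_biprod {A X : C} (r : Retract (S.toStable.obj A) (S.toStable.obj X)) :
    ∃ J : C, S.inj J ∧ Nonempty (Retract A (X ⊞ J)) := by
  obtain ⟨i, hi⟩ := S.toStable.map_surjective r.i
  obtain ⟨p, hp⟩ := S.toStable.map_surjective r.r
  obtain ⟨J, a, b, hJ, hab⟩ := (toStable_map_eq_zero_iff (𝟙 A - i ≫ p)).1 (by
    rw [S.toStable.map_sub, S.toStable.map_comp, hi, hp, r.retract, S.toStable.map_id, sub_self])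
  exact ⟨J, hJ, ⟨biprod.lift i a, biprod.desc p b, by rw [biprod.lift_desc, ← hab]; abel⟩⟩

lemma IsThick.isThickTriangulatedSubcategory_mapF (σ : ∀ X : C, S.InjSeq X)
    {D : ObjectProperty C} (hD : S.IsThick D) (hI : S.inj ≤ D) :
    IsThickTriangulatedSubcategory (distinguished σ) (S.mapF D) where
  toIsTriangulatedSubcategory := hD.toIsComplete.isTriangulatedSubcategory_mapF σ hI
  summand := fun {A X} r hX => by
    obtain ⟨J, hJ, ⟨r'⟩⟩ := exists_retract_biprod (A := A.as) (X := X.as) r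
    obtain ⟨q, w, hq⟩ := conflation_biprod S X.as J
    exact hD.summand r' (hD.middle _ hq hX (hI _ hJ))

/-! ### From subcategories of the stable category to the exact category -/

/-- The triangle `X ⟶ Y ⟶ Z ⟶ T X` on a stable isomorphism `X ⟶ Y`, with `Z` any zero object. -/
lemma exists_distinguished_of_iso (σ : ∀ X : C, S.InjSeq X) {X Y Z : S.Stable} (e : X ≅ Y)
    (hZ : IsZero Z) : ∃ A ∈ distinguished σ, A.X = X ∧ A.Y = Y ∧ A.Z = Z := by
  obtain ⟨E, f', g, h, w, po, comm, mem⟩ := exists_standard σ (𝟙 X.as)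
  have hE : IsZero (S.toStable.obj E) :=
    isZero_toStable_obj (inj_cone_of_isIso (σ X.as) po comm mem)
  exact ⟨⟨e.hom, 0, 0⟩, ⟨_, .mk _ f' g h w po comm mem, Iso.refl _, e.symm, hZ.iso hE,
    by simp, hE.eq_of_tgt _ _, hZ.eq_of_src _ _⟩, rfl, rfl, rfl⟩

lemma invOn_mapG_mapF (s : Set (ObjectProperty C)) (t : Set (ObjectProperty S.Stable)) :
    Set.InvOn S.mapG S.mapF s t :=
  ⟨fun _ _ => rfl, fun _ _ => rfl⟩

end ExactStructure

open ExactStructure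
open scoped ZeroObject

variable {C : Type u} [Category.{v} C] [Preadditive C] [HasZeroObject C] [HasBinaryBiproducts C]
  {S : ExactStructure C}

lemma IsTriangulatedSubcategory.of_isZero {σ : ∀ X : C, S.InjSeq X} {P : ObjectProperty S.Stable}
    (hP : IsTriangulatedSubcategory (distinguished σ) P) {Z : S.Stable} (hZ : IsZero Z) : P Z := by
  obtain ⟨X, hX⟩ := hP.nonempty
  obtain ⟨A, hA, rfl, hY, rfl⟩ := exists_distinguished_of_iso σ (Iso.refl X) hZ
  exact hP.right A hA hX (hY ▸ hX)

lemma IsTriangulatedSubcategory.of_iso {σ : ∀ X : C, S.InjSeq X} {P : ObjectProperty S.Stable}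
    (hP : IsTriangulatedSubcategory (distinguished σ) P) {X Y : S.Stable} (e : X ≅ Y)
    (hX : P X) : P Y := by
  have hZ : IsZero (S.toStable.obj 0) := isZero_toStable_obj (S.inj_zero (isZero_zero C))
  obtain ⟨A, hA, rfl, rfl, hAZ⟩ := exists_distinguished_of_iso σ e hZ
  exact hP.middle A hA hX (hAZ ▸ hP.of_isZero hZ)

lemma IsTriangulatedSubcategory.inj_le_mapG {σ : ∀ X : C, S.InjSeq X}
    {P : ObjectProperty S.Stable} (hP : IsTriangulatedSubcategory (distinguished σ) P) :
    S.inj ≤ S.mapG P :=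
  fun _ hI => hP.of_isZero (isZero_toStable_obj hI)

lemma IsTriangulatedSubcategory.isComplete_mapG {σ : ∀ X : C, S.InjSeq X}
    {P : ObjectProperty S.Stable} (hP : IsTriangulatedSubcategory (distinguished σ) P) :
    S.IsComplete (S.mapG P) where
  nonempty := hP.nonempty.imp' (fun X : S.Stable => X.as) fun _ h => h
  left := fun K hK hY hZ => by
    obtain ⟨A, hA, hAX, hAY, ⟨e⟩⟩ := exists_distinguished_of_conflation σ hK
    change P (S.toStable.obj K.X₁)
    exact hAX ▸ hP.left A hA (hAY ▸ hY) (hP.of_iso e.symm hZ)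
  middle := fun K hK hX hZ => by
    obtain ⟨A, hA, hAX, hAY, ⟨e⟩⟩ := exists_distinguished_of_conflation σ hK
    change P (S.toStable.obj K.X₂)
    exact hAY ▸ hP.middle A hA (hAX ▸ hX) (hP.of_iso e.symm hZ)
  right := fun K hK hX hY => by
    obtain ⟨A, hA, hAX, hAY, ⟨e⟩⟩ := exists_distinguished_of_conflation σ hK
    exact hP.of_iso e (hP.right A hA (hAX ▸ hX) (hAY ▸ hY))

lemma IsThickTriangulatedSubcategory.isThick_mapG {σ : ∀ X : C, S.InjSeq X}
    {P : ObjectProperty S.Stable} (hP : IsThickTriangulatedSubcategory (distinguished σ) P) :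
    S.IsThick (S.mapG P) where
  toIsComplete := hP.toIsTriangulatedSubcategory.isComplete_mapG
  summand := fun r hX => hP.summand (r.map S.toStable) hX

end FrobeniusClassification

theorem mainTheorem3 {C : Type u} [Category.{v} C] [Preadditive C] [HasZeroObject C]
    [HasBinaryBiproducts C] (S : FrobeniusClassification.ExactStructure C) (hS : S.IsFrobenius)
    (σ : ∀ X : C, S.InjSeq X) :
    (Set.BijOn S.mapF {D | S.IsThick D ∧ S.inj ≤ D}
        {P | FrobeniusClassification.IsThickTriangulatedSubcategory
          (FrobeniusClassification.ExactStructure.distinguished σ) P} ∧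
      Set.BijOn S.mapG
        {P | FrobeniusClassification.IsThickTriangulatedSubcategory
          (FrobeniusClassification.ExactStructure.distinguished σ) P}
        {D | S.IsThick D ∧ S.inj ≤ D} ∧
      Set.InvOn S.mapG S.mapF {D | S.IsThick D ∧ S.inj ≤ D}
        {P | FrobeniusClassification.IsThickTriangulatedSubcategory
          (FrobeniusClassification.ExactStructure.distinguished σ) P}) ∧
    (Set.BijOn S.mapF {D | S.IsComplete D ∧ S.inj ≤ D}
        {P | FrobeniusClassification.IsTriangulatedSubcategory
          (FrobeniusClassification.ExactStructure.distinguished σ) P} ∧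
      Set.BijOn S.mapG
        {P | FrobeniusClassification.IsTriangulatedSubcategory
          (FrobeniusClassification.ExactStructure.distinguished σ) P}
        {D | S.IsComplete D ∧ S.inj ≤ D} ∧
      Set.InvOn S.mapG S.mapF {D | S.IsComplete D ∧ S.inj ≤ D}
        {P | FrobeniusClassification.IsTriangulatedSubcategory
          (FrobeniusClassification.ExactStructure.distinguished σ) P}) := by
  have hF : Set.MapsTo S.mapF {D | S.IsThick D ∧ S.inj ≤ D}
      {P | FrobeniusClassification.IsThickTriangulatedSubcategory
        (FrobeniusClassification.ExactStructure.distinguished σ) P} :=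
    fun _ hD => hD.1.isThickTriangulatedSubcategory_mapF σ hD.2
  have hG : Set.MapsTo S.mapG
      {P | FrobeniusClassification.IsThickTriangulatedSubcategory
        (FrobeniusClassification.ExactStructure.distinguished σ) P}
      {D | S.IsThick D ∧ S.inj ≤ D} :=
    fun _ hP => ⟨hP.isThick_mapG, hP.toIsTriangulatedSubcategory.inj_le_mapG⟩
  have hF' : Set.MapsTo S.mapF {D | S.IsComplete D ∧ S.inj ≤ D}
      {P | FrobeniusClassification.IsTriangulatedSubcategory
        (FrobeniusClassification.ExactStructure.distinguished σ) P} :=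
    fun _ hD => hD.1.isTriangulatedSubcategory_mapF σ hD.2
  have hG' : Set.MapsTo S.mapG
      {P | FrobeniusClassification.IsTriangulatedSubcategory
        (FrobeniusClassification.ExactStructure.distinguished σ) P}
      {D | S.IsComplete D ∧ S.inj ≤ D} :=
    fun _ hP => ⟨hP.isComplete_mapG, hP.inj_le_mapG⟩
  have inv := FrobeniusClassification.ExactStructure.invOn_mapG_mapF (S := S)
  exact ⟨⟨(inv _ _).bijOn hF hG, (inv _ _).symm.bijOn hG hF, inv _ _⟩,
    ⟨(inv _ _).bijOn hF' hG', (inv _ _).symm.bijOn hG' hF', inv _ _⟩⟩
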